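/- Let $A$ be an $f$-algebra, i.e. a real vector lattice and associative real algebra (not necessarily unital) such that products of positive elements are positive and $a\wedge b=0$, $c\ge 0$ imply $(ca)\wedge b=(ac)\wedge b=0$. Let $A^{\sim}$ be its order dual, i.e. the vector lattice of all order bounded linear functionals on $A$, ordered by $f\le g$ iff $f(a)\le g(a)$ for all $a\ge 0$. Assume that $A^{\sim}$ separates the points of $A$. Let $(A^{\sim})^{\sim}_n$ be the set of all order continuous order bounded linear functionals on $A^{\sim}$. For $f\in A^{\sim}$, $a\in A$ and $F\in (A^{\sim})^{\sim}_n$ define $f\cdot a\in A^{\sim}$ by $(f\cdot a)(b)=f(ab)$ for $b\in A$, and $F\cdot f\in A^{\sim}$ by $(F\cdot f)(a)=F(f\cdot a)$ for $a\in A$, and put $$R(f)=\{F\cdot f : F\in (A^{\sim})^{\sim}_n\}.$$ Then, for every $f\in A^{\sim}$, $R(f)=R(|f|)$, and $R(f)$ is an order ideal in $A^{\sim}$, i.e. a linear subspace such that $|g|\le|h|$ and $h\in R(f)$ imply $g\in R(f)$. -/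

import Mathlib

open Set Filter Topology

set_option linter.unusedSectionVars false
set_option linter.unusedVariables false

/-!
Riesz spaces (vector lattices) are real modules with a lattice order satisfying
`IsOrderedAddMonoid` and `IsOrderedModule ℝ`.
-/

section RieszSpace

variable (L : Type*) [AddCommGroup L] [Module ℝ L] [Lattice L]

/-- The linear functionals on `L` which are bounded on every order interval. -/
def orderBoundedFunctionals : Submodule ℝ (L →ₗ[ℝ] ℝ) where
  carrier := {f | ∀ x y : L, ∃ C : ℝ, ∀ z ∈ Icc x y, |f z| ≤ C}
  zero_mem' := fun x y => ⟨0, fun z _ => by simp⟩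
  add_mem' := by
    intro f g hf hg x y
    obtain ⟨C, hC⟩ := hf x y
    obtain ⟨D, hD⟩ := hg x y
    exact ⟨C + D, fun z hz => (abs_add_le _ _).trans (add_le_add (hC z hz) (hD z hz))⟩
  smul_mem' := by
    intro c f hf x y
    obtain ⟨C, hC⟩ := hf x y
    refine ⟨|c| * C, fun z hz => ?_⟩
    rw [LinearMap.smul_apply, smul_eq_mul, abs_mul]
    exact mul_le_mul_of_nonneg_left (hC z hz) (abs_nonneg c)

/-- The order dual `L~` of a Riesz space `L`: the space of order bounded linear functionals.
Its order, `f ≤ g` iff `f x ≤ g x` for all `x ≥ 0`, is introduced below. -/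
def OrdDual : Type _ := ↥(orderBoundedFunctionals L)

namespace OrdDual

variable {L}

instance : AddCommGroup (OrdDual L) := inferInstanceAs (AddCommGroup ↥(orderBoundedFunctionals L))

instance : Module ℝ (OrdDual L) := inferInstanceAs (Module ℝ ↥(orderBoundedFunctionals L))

/-- The linear functional underlying an element of the order dual. -/
def toLin (f : OrdDual L) : L →ₗ[ℝ] ℝ := f.1

/-- An order bounded linear functional as an element of the order dual. -/
def mk (f : L →ₗ[ℝ] ℝ) (hf : ∀ x y : L, ∃ C : ℝ, ∀ z ∈ Icc x y, |f z| ≤ C) : OrdDual L := ⟨f, hf⟩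

instance : FunLike (OrdDual L) L ℝ where
  coe f := f.toLin
  coe_injective := fun _ _ h => Subtype.ext (DFunLike.coe_injective h)

instance : LinearMapClass (OrdDual L) ℝ L ℝ where
  map_add f := f.toLin.map_add
  map_smulₛₗ f := f.toLin.map_smul

@[ext] theorem ext {f g : OrdDual L} (h : ∀ x, f x = g x) : f = g := DFunLike.ext _ _ h

@[simp] theorem mk_apply (f : L →ₗ[ℝ] ℝ) (hf) (x : L) : mk f hf x = f x := rfl
@[simp] theorem add_apply (f g : OrdDual L) (x : L) : (f + g) x = f x + g x := rfl
@[simp] theorem sub_apply (f g : OrdDual L) (x : L) : (f - g) x = f x - g x := rfl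
@[simp] theorem neg_apply (f : OrdDual L) (x : L) : (-f) x = -f x := rfl
@[simp] theorem zero_apply (x : L) : (0 : OrdDual L) x = 0 := rfl
@[simp] theorem smul_apply (c : ℝ) (f : OrdDual L) (x : L) : (c • f) x = c * f x := rfl

theorem bounded (f : OrdDual L) (x y : L) : ∃ C : ℝ, ∀ z ∈ Icc x y, |f z| ≤ C := f.2 x y

variable [IsOrderedAddMonoid L] [IsOrderedModule ℝ L]

theorem eq_of_nonneg {f g : OrdDual L} (h : ∀ x, 0 ≤ x → f x = g x) : f = g := by
  ext x
  rw [← posPart_sub_negPart x, map_sub, map_sub, h _ (posPart_nonneg x), h _ (negPart_nonneg x)]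

instance : PartialOrder (OrdDual L) where
  le f g := ∀ x : L, 0 ≤ x → f x ≤ g x
  le_refl _ _ _ := le_rfl
  le_trans _ _ _ hfg hgh x hx := (hfg x hx).trans (hgh x hx)
  le_antisymm _ _ hfg hgf := eq_of_nonneg fun x hx => le_antisymm (hfg x hx) (hgf x hx)

theorem le_def {f g : OrdDual L} : f ≤ g ↔ ∀ x : L, 0 ≤ x → f x ≤ g x := Iff.rfl

instance : IsOrderedAddMonoid (OrdDual L) where
  add_le_add_left f g h k x hx := by simpa using h x hx

instance : IsOrderedModule ℝ (OrdDual L) where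
  smul_le_smul_of_nonneg_left c hc f g h x hx := mul_le_mul_of_nonneg_left (h x hx) hc
  smul_le_smul_of_nonneg_right f hf c d h x hx := mul_le_mul_of_nonneg_right h (hf x hx)

/-- The supremum of `f` over the order interval `[0, x]`; for `x ≥ 0` this is the value at `x` of
the positive part of `f`. -/
noncomputable def posSup (f : OrdDual L) (x : L) : ℝ := sSup (f '' Icc 0 x)

theorem le_posSup (f : OrdDual L) {x y : L} (hy : 0 ≤ y) (hyx : y ≤ x) : f y ≤ posSup f x := by
  obtain ⟨C, hC⟩ := f.bounded 0 x
  refine le_csSup ⟨C, ?_⟩ ⟨y, ⟨hy, hyx⟩, rfl⟩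
  rintro _ ⟨z, hz, rfl⟩
  exact (le_abs_self _).trans (hC z hz)

theorem posSup_le (f : OrdDual L) {x : L} (hx : 0 ≤ x) {b : ℝ}
    (h : ∀ y, 0 ≤ y → y ≤ x → f y ≤ b) : posSup f x ≤ b := by
  refine csSup_le ⟨f 0, 0, ⟨le_rfl, hx⟩, rfl⟩ ?_
  rintro _ ⟨z, hz, rfl⟩
  exact h z hz.1 hz.2

theorem posSup_add (f : OrdDual L) {x y : L} (hx : 0 ≤ x) (hy : 0 ≤ y) :
    posSup f (x + y) = posSup f x + posSup f y := by
  apply le_antisymm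
  · refine posSup_le f (add_nonneg hx hy) fun z hz hzxy => ?_
    have h1 : f (z ⊓ x) ≤ posSup f x := le_posSup f (le_inf hz hx) inf_le_right
    have h2 : f (z - z ⊓ x) ≤ posSup f y := by
      refine le_posSup f (sub_nonneg.2 inf_le_left) ?_
      rw [sub_le_iff_le_add, inf_comm, add_inf]
      exact le_inf (by rwa [add_comm]) (le_add_of_nonneg_left hy)
    rw [map_sub] at h2
    linarith
  · rw [← le_sub_iff_add_le]
    refine posSup_le f hx fun u hu hux => ?_
    rw [le_sub_comm]
    refine posSup_le f hy fun v hv hvy => ?_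
    have := le_posSup f (add_nonneg hu hv) (add_le_add hux hvy)
    rw [map_add] at this
    linarith

theorem posSup_smul (f : OrdDual L) {c : ℝ} (hc : 0 ≤ c) {x : L} (hx : 0 ≤ x) :
    posSup f (c • x) = c * posSup f x := by
  have key : ∀ (d : ℝ), 0 < d → ∀ y : L, 0 ≤ y → d * posSup f y ≤ posSup f (d • y) := by
    intro d hd y hy
    rw [← le_div_iff₀' hd]
    refine posSup_le f hy fun z hz hzy => ?_
    rw [le_div_iff₀' hd]
    have := le_posSup f (smul_nonneg hd.le hz) (smul_le_smul_of_nonneg_left hzy hd.le)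
    rwa [map_smul, smul_eq_mul] at this
  rcases hc.eq_or_lt with rfl | hc
  · rw [zero_smul, zero_mul]
    apply le_antisymm
    · refine posSup_le f le_rfl fun y h1 h2 => ?_
      rw [le_antisymm h2 h1, map_zero]
    · simpa using le_posSup f (le_refl (0 : L)) le_rfl
  · apply le_antisymm _ (key c hc x hx)
    have := key c⁻¹ (inv_pos.2 hc) (c • x) (smul_nonneg hc.le hx)
    rwa [inv_smul_smul₀ hc.ne', inv_mul_le_iff₀ hc] at this

theorem posSup_sub_eq (f : OrdDual L) {x u v : L} (hu : 0 ≤ u) (hv : 0 ≤ v) (h : x = u - v) :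
    posSup f x⁺ - posSup f x⁻ = posSup f u - posSup f v := by
  have e : x⁺ + v = u + x⁻ := by
    have := posPart_sub_negPart x
    rw [sub_eq_iff_eq_add] at this
    rw [this, h]; abel
  have e' := congrArg (posSup f) e
  rw [posSup_add f (posPart_nonneg x) hv, posSup_add f hu (negPart_nonneg x)] at e'
  linarith

/-- The positive part of `f`: the linear functional with value `sup {f y | 0 ≤ y ≤ x}` at each
`x ≥ 0` (Riesz–Kantorovich formula). -/
noncomputable def posLin (f : OrdDual L) : L →ₗ[ℝ] ℝ where
  toFun x := posSup f x⁺ - posSup f x⁻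
  map_add' x y := by
    rw [posSup_sub_eq f (add_nonneg (posPart_nonneg x) (posPart_nonneg y))
      (add_nonneg (negPart_nonneg x) (negPart_nonneg y))
      (by rw [add_sub_add_comm, posPart_sub_negPart, posPart_sub_negPart]),
      posSup_add f (posPart_nonneg x) (posPart_nonneg y),
      posSup_add f (negPart_nonneg x) (negPart_nonneg y)]
    ring
  map_smul' c x := by
    rcases le_total 0 c with hc | hc
    · rw [posSup_sub_eq f (smul_nonneg hc (posPart_nonneg x)) (smul_nonneg hc (negPart_nonneg x))
        (by rw [← smul_sub, posPart_sub_negPart]), posSup_smul f hc (posPart_nonneg x),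
        posSup_smul f hc (negPart_nonneg x)]
      simp only [RingHom.id_apply, smul_eq_mul]
      ring
    · have hc' : 0 ≤ -c := neg_nonneg.2 hc
      rw [posSup_sub_eq f (smul_nonneg hc' (negPart_nonneg x)) (smul_nonneg hc' (posPart_nonneg x))
        (by rw [← smul_sub, neg_smul, ← smul_neg, neg_sub, posPart_sub_negPart]),
        posSup_smul f hc' (posPart_nonneg x), posSup_smul f hc' (negPart_nonneg x)]
      simp only [RingHom.id_apply, smul_eq_mul]
      ring

theorem posLin_apply (f : OrdDual L) {x : L} (hx : 0 ≤ x) : posLin f x = posSup f x := by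
  have h0 : posSup f (0 : L) = 0 := by simpa using posSup_smul f le_rfl (le_refl (0 : L))
  have := posSup_sub_eq f hx le_rfl (sub_zero x).symm
  rw [h0, sub_zero] at this
  exact this

/-- A positive linear functional is order bounded. -/
theorem bounded_of_nonneg (g : L →ₗ[ℝ] ℝ) (hg : ∀ x, 0 ≤ x → 0 ≤ g x) (x y : L) :
    ∃ C : ℝ, ∀ z ∈ Icc x y, |g z| ≤ C := by
  refine ⟨|g x| + |g y|, fun z hz => ?_⟩
  have h1 := hg _ (sub_nonneg.2 hz.1)
  have h2 := hg _ (sub_nonneg.2 hz.2)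
  rw [map_sub] at h1 h2
  rw [abs_le]
  constructor
  · linarith [neg_abs_le (g x), abs_nonneg (g y)]
  · linarith [le_abs_self (g y), abs_nonneg (g x)]

theorem posLin_nonneg (f : OrdDual L) (x : L) (hx : 0 ≤ x) : 0 ≤ posLin f x := by
  rw [posLin_apply f hx]
  simpa using le_posSup f le_rfl hx

/-- The positive part of `f` as an element of the order dual. -/
noncomputable def pos (f : OrdDual L) : OrdDual L :=
  mk (posLin f) (bounded_of_nonneg _ (posLin_nonneg f))

theorem pos_apply (f : OrdDual L) {x : L} (hx : 0 ≤ x) : pos f x = sSup (f '' Icc 0 x) :=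
  posLin_apply f hx

theorem isLUB_pos (f : OrdDual L) : IsLUB {f, 0} (pos f) := by
  constructor
  · rintro g (rfl | rfl) x hx
    · rw [pos_apply _ hx]; exact le_posSup _ hx le_rfl
    · exact posLin_nonneg f x hx
  · intro g hg x hx
    have h1 : f ≤ g := hg (Or.inl rfl)
    have h2 : 0 ≤ g := hg (Or.inr rfl)
    rw [pos_apply _ hx]
    refine posSup_le f hx fun y hy hyx => (h1 y hy).trans ?_
    have := h2 _ (sub_nonneg.2 hyx)
    simp only [map_sub, zero_apply] at this
    linarith

/-- The order dual is a Riesz space. The supremum and infimum are those of the order above. -/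
noncomputable instance : Lattice (OrdDual L) where
  sup f g := g + pos (f - g)
  le_sup_left f g := by
    have := (isLUB_pos (f - g)).1 (Or.inl rfl)
    exact sub_le_iff_le_add'.1 this
  le_sup_right f g := by
    have := (isLUB_pos (f - g)).1 (Or.inr rfl)
    exact le_add_of_nonneg_right this
  sup_le f g h hf hg := by
    have : pos (f - g) ≤ h - g := by
      refine (isLUB_pos (f - g)).2 ?_
      rintro k (rfl | rfl)
      · exact sub_le_sub_right hf g
      · exact sub_nonneg.2 hg
    exact le_sub_iff_add_le'.1 this
  inf f g := f - pos (f - g)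
  inf_le_left f g := by
    have := (isLUB_pos (f - g)).1 (Or.inr rfl)
    exact sub_le_self f this
  inf_le_right f g := by
    have := (isLUB_pos (f - g)).1 (Or.inl rfl)
    exact sub_le_comm.1 this
  le_inf h f g hf hg := by
    have : pos (f - g) ≤ f - h := by
      refine (isLUB_pos (f - g)).2 ?_
      rintro k (rfl | rfl)
      · exact sub_le_sub_left hg f
      · exact sub_nonneg.2 hf
    exact le_sub_comm.1 this

/-- `f` is order continuous: `f x_α → 0` for every net `x_α ↓ 0`. A decreasing net is represented
by its range, a nonempty downward directed set `D` with infimum `0`. -/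
def IsOrderContinuous (f : OrdDual L) : Prop :=
  ∀ D : Set L, D.Nonempty → DirectedOn (· ≥ ·) D → IsGLB D 0 →
    Tendsto (fun d : D => f d) atBot (𝓝 0)

end OrdDual

/-- The order dual separates the points of `L`: if `f x = 0` for all `f` in the order dual,
then `x = 0`. -/
def HasSeparatingOrdDual : Prop := ∀ x : L, (∀ f : OrdDual L, f x = 0) → x = 0

variable {L}

/-- An order ideal of `L`: a linear subspace `S` such that `|y| ≤ |x|` and `x ∈ S` imply
`y ∈ S`. -/
def IsOrderIdeal (S : Set L) : Prop :=
  (∃ I : Submodule ℝ L, (I : Set L) = S) ∧ LatticeOrderedAddCommGroup.IsSolid S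

end RieszSpace

/-- An `f`-algebra (not necessarily unital): a Riesz space which is an associative real algebra
whose multiplication satisfies the conditions below. -/
class IsFAlgebra (A : Type*) [NonUnitalRing A] [Module ℝ A] [Lattice A] : Prop extends
    IsOrderedAddMonoid A, IsOrderedModule ℝ A, IsScalarTower ℝ A A, SMulCommClass ℝ A A where
  mul_nonneg : ∀ a b : A, 0 ≤ a → 0 ≤ b → 0 ≤ a * b
  mul_left_disjoint : ∀ a b c : A, a ⊓ b = 0 → 0 ≤ c → (c * a) ⊓ b = 0
  mul_right_disjoint : ∀ a b c : A, a ⊓ b = 0 → 0 ≤ c → (a * c) ⊓ b = 0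

section FAlgebra

variable {A : Type*} [NonUnitalRing A] [Module ℝ A] [Lattice A] [IsFAlgebra A]

namespace OrdDual

theorem mul_mem_Icc {a : A} (ha : 0 ≤ a) {x y z : A} (hz : z ∈ Icc x y) :
    a * z ∈ Icc (a * x) (a * y) := by
  constructor
  · rw [← sub_nonneg, ← mul_sub]
    exact IsFAlgebra.mul_nonneg _ _ ha (sub_nonneg.2 hz.1)
  · rw [← sub_nonneg, ← mul_sub]
    exact IsFAlgebra.mul_nonneg _ _ ha (sub_nonneg.2 hz.2)

/-- The functional `f · a`, given by `(f · a)(b) = f (a b)`. -/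
def dotElem (f : OrdDual A) (a : A) : OrdDual A :=
  mk (f.toLin ∘ₗ LinearMap.mulLeft ℝ a) (by
    intro x y
    obtain ⟨C, hC⟩ := f.bounded (a⁺ * x) (a⁺ * y)
    obtain ⟨D, hD⟩ := f.bounded (a⁻ * x) (a⁻ * y)
    refine ⟨C + D, fun z hz => ?_⟩
    have e : (f.toLin ∘ₗ LinearMap.mulLeft ℝ a) z = f (a⁺ * z) - f (a⁻ * z) := by
      rw [← map_sub, ← sub_mul, posPart_sub_negPart]
      rfl
    rw [e]
    exact (abs_sub _ _).trans (add_le_add (hC _ (mul_mem_Icc (posPart_nonneg a) hz))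
      (hD _ (mul_mem_Icc (negPart_nonneg a) hz))))

@[simp] theorem dotElem_apply (f : OrdDual A) (a b : A) : dotElem f a b = f (a * b) := rfl

/-- The linear functional `a ↦ F (f · a)` on `A`. -/
noncomputable def dotLin (F : OrdDual (OrdDual A)) (f : OrdDual A) : A →ₗ[ℝ] ℝ where
  toFun a := F (dotElem f a)
  map_add' a b := by
    rw [← map_add]
    congr 1
    ext x
    simp [add_mul]
  map_smul' c a := by
    rw [RingHom.id_apply, ← map_smul]
    congr 1
    ext x
    simp [smul_mul_assoc]

theorem dotLin_bounded (F : OrdDual (OrdDual A)) (f : OrdDual A) (x y : A) :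
    ∃ C : ℝ, ∀ z ∈ Icc x y, |dotLin F f z| ≤ C := by
  have mono : ∀ g : OrdDual A, 0 ≤ g → ∀ z ∈ Icc x y,
      dotElem g z ∈ Icc (dotElem g x) (dotElem g y) := by
    intro g hg z hz
    constructor
    · intro b hb
      have := hg _ (IsFAlgebra.mul_nonneg _ _ (sub_nonneg.2 hz.1) hb)
      rw [sub_mul, map_sub, zero_apply] at this
      simpa using this
    · intro b hb
      have := hg _ (IsFAlgebra.mul_nonneg _ _ (sub_nonneg.2 hz.2) hb)
      rw [sub_mul, map_sub, zero_apply] at this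
      simpa using this
  obtain ⟨C, hC⟩ := F.bounded (dotElem f⁺ x) (dotElem f⁺ y)
  obtain ⟨D, hD⟩ := F.bounded (dotElem f⁻ x) (dotElem f⁻ y)
  refine ⟨C + D, fun z hz => ?_⟩
  have e : dotLin F f z = F (dotElem f⁺ z) - F (dotElem f⁻ z) := by
    rw [← map_sub]
    change F _ = F _
    congr 1
    ext b
    rw [sub_apply, dotElem_apply, dotElem_apply, dotElem_apply, ← sub_apply, posPart_sub_negPart]
  rw [e]
  exact (abs_sub _ _).trans (add_le_add (hC _ (mono _ (posPart_nonneg f) z hz))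
    (hD _ (mono _ (negPart_nonneg f) z hz)))

/-- The functional `F · f` in the order dual of `A`, given by `(F · f)(a) = F (f · a)`. -/
noncomputable def dot (F : OrdDual (OrdDual A)) (f : OrdDual A) : OrdDual A := mk (dotLin F f) (dotLin_bounded F f)

@[simp] theorem dot_apply (F : OrdDual (OrdDual A)) (f : OrdDual A) (a : A) :
    dot F f a = F (dotElem f a) := rfl

/-- `R(f) = {F · f | F}`, where `F` runs through the order continuous part of the order bidual
of `A`. -/
def R (f : OrdDual A) : Set (OrdDual A) :=
  {g | ∃ F : OrdDual (OrdDual A), F.IsOrderContinuous ∧ dot F f = g}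

end OrdDual

end FAlgebra

/-! The key identity is `|f · a| = |f| · |a|`. It follows from two disjointness statements: for `f ≥
0`, disjoint `a`, `u` give disjoint `f · a`, `f · u`; for `a ≥ 0`, disjoint `f`, `g` give disjoint
`f · a`, `g · a`. From it, `R(f)` consists of all `g` with `|g| ≤ H · |f|` for some positive order
continuous `H` (`mem_R_iff`), a condition that depends only on `|f|` and is solid in `g`. One
direction is `|F · f| ≤ |F| · |f|`, where `|F|` is again order continuous. For the other, `|g a| ≤ H
|f · a|`, so Hahn–Banach factors `g` through `a ↦ f · a` by a functional dominated by `H`, hence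
order continuous. -/

namespace OrdDual

/-! ### Order continuous functionals. -/

section RieszSpace

variable {L : Type*} [AddCommGroup L] [Module ℝ L] [Lattice L]

theorem IsOrderContinuous.add {F G : OrdDual L} (hF : F.IsOrderContinuous)
    (hG : G.IsOrderContinuous) : (F + G).IsOrderContinuous := by
  intro D hne hdir hglb
  simpa using (hF D hne hdir hglb).add (hG D hne hdir hglb)

theorem IsOrderContinuous.smul {F : OrdDual L} (hF : F.IsOrderContinuous) (c : ℝ) :
    (c • F).IsOrderContinuous := by
  intro D hne hdir hglb
  simpa using (hF D hne hdir hglb).const_mul c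

theorem IsOrderContinuous.neg {F : OrdDual L} (hF : F.IsOrderContinuous) :
    (-F).IsOrderContinuous := by
  intro D hne hdir hglb
  simpa using (hF D hne hdir hglb).neg

theorem isOrderContinuous_zero : (0 : OrdDual L).IsOrderContinuous := by
  intro D hne hdir hglb
  exact tendsto_const_nhds

variable [IsOrderedAddMonoid L] [IsOrderedModule ℝ L]

theorem apply_nonneg {F : OrdDual L} (hF : 0 ≤ F) {x : L} (hx : 0 ≤ x) : 0 ≤ F x := hF x hx

theorem apply_mono {F : OrdDual L} (hF : 0 ≤ F) {x y : L} (hxy : x ≤ y) : F x ≤ F y := by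
  have := apply_nonneg hF (sub_nonneg.2 hxy)
  rw [map_sub] at this
  linarith

theorem abs_apply_le (f : OrdDual L) (x : L) : |f x| ≤ |f| |x| := by
  have h1 : ∀ y : L, 0 ≤ y → |f y| ≤ |f| y := fun y hy =>
    abs_le'.2 ⟨le_abs_self f y hy, neg_le_abs f y hy⟩
  have h2 := h1 _ (posPart_nonneg x)
  have h3 := h1 _ (negPart_nonneg x)
  rw [← posPart_add_negPart x, map_add]
  calc |f x| = |f x⁺ - f x⁻| := by rw [← map_sub, posPart_sub_negPart]
    _ ≤ |f x⁺| + |f x⁻| := abs_sub _ _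
    _ ≤ _ := add_le_add h2 h3

theorem IsOrderContinuous.of_abs_le {F G : OrdDual L} (hF : F.IsOrderContinuous)
    (h : ∀ x : L, 0 ≤ x → |G x| ≤ F x) : G.IsOrderContinuous := by
  intro D hne hdir hglb
  exact squeeze_zero_norm (fun d => h d (hglb.1 d.2)) (hF D hne hdir hglb)

/-- If `D` decreases to `0` and `F` is order continuous, then `F (y ⊓ d)` is eventually small. -/
theorem IsOrderContinuous.exists_apply_inf_lt {F : OrdDual L} (hF : F.IsOrderContinuous)
    {D : Set L} (hne : D.Nonempty) (hdir : DirectedOn (· ≥ ·) D) (hglb : IsGLB D 0)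
    {y : L} (hy : 0 ≤ y) (d₀ : D) {ε : ℝ} (hε : 0 < ε) :
    ∃ d : D, d ≤ d₀ ∧ F (y ⊓ d) < ε := by
  have hdir' : DirectedOn (· ≥ ·) ((y ⊓ ·) '' D) := by
    rintro _ ⟨d, hd, rfl⟩ _ ⟨e, he, rfl⟩
    obtain ⟨k, hk, hkd, hke⟩ := hdir d hd e he
    exact ⟨y ⊓ k, ⟨k, hk, rfl⟩, inf_le_inf_left y hkd, inf_le_inf_left y hke⟩
  have hglb' : IsGLB ((y ⊓ ·) '' D) 0 := by
    constructor
    · rintro _ ⟨d, hd, rfl⟩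
      exact le_inf hy (hglb.1 hd)
    · intro b hb
      exact hglb.2 fun d hd => (hb ⟨d, hd, rfl⟩).trans inf_le_right
  have ht := hF _ (hne.image _) hdir' hglb'
  have : Nonempty ((y ⊓ ·) '' D) := (hne.image _).to_subtype
  have : IsDirected ((y ⊓ ·) '' D) (· ≥ ·) := ⟨fun a b => by
    obtain ⟨c, hc, h1, h2⟩ := hdir' a a.2 b b.2
    exact ⟨⟨c, hc⟩, h1, h2⟩⟩
  obtain ⟨⟨_, e, he, rfl⟩, hk⟩ := Filter.eventually_atBot.1 (ht.eventually_lt_const hε)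
  obtain ⟨d, hd, hd₀, hde⟩ := hdir d₀ d₀.2 e he
  exact ⟨⟨d, hd⟩, hd₀, hk ⟨y ⊓ d, d, hd, rfl⟩ (inf_le_inf_left y hde)⟩

/-- Let `y ∈ [0, d₀]` almost attain `F⁺ d₀`. For `d ≤ d₀`, `y - y ⊓ d ≤ d₀ - d`, so `F⁺ d ≤ (F⁺ d₀ -
F y) + F (y ⊓ d)`, and both terms can be made small. -/
theorem IsOrderContinuous.pos {F : OrdDual L} (hF : F.IsOrderContinuous) :
    (pos F).IsOrderContinuous := by
  intro D hne hdir hglb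
  have hpos : 0 ≤ OrdDual.pos F := (isLUB_pos F).1 (Or.inr rfl)
  have : Nonempty D := hne.to_subtype
  obtain ⟨d₀⟩ := ‹Nonempty D›
  rw [Metric.tendsto_nhds]
  intro ε hε
  have hd₀ : (0 : L) ≤ d₀ := hglb.1 d₀.2
  obtain ⟨_, ⟨y, hy, rfl⟩, hlt⟩ := exists_lt_of_lt_csSup
    (⟨F 0, 0, ⟨le_rfl, hd₀⟩, rfl⟩ : (F '' Icc 0 (d₀ : L)).Nonempty)
    (show OrdDual.pos F d₀ - ε / 2 < sSup (F '' Icc 0 (d₀ : L)) by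
      rw [← pos_apply F hd₀]; linarith)
  obtain ⟨d, hd, hFd⟩ := hF.exists_apply_inf_lt hne hdir hglb hy.1 d₀ (half_pos hε)
  have key : F (y - y ⊓ d) ≤ OrdDual.pos F (d₀ - d) := by
    rw [pos_apply F (sub_nonneg.2 hd)]
    refine le_posSup F (sub_nonneg.2 inf_le_left) ?_
    rw [sub_le_iff_le_add, add_inf]
    refine le_inf (le_add_of_nonneg_left (sub_nonneg.2 hd)) ?_
    rw [sub_add_cancel]
    exact hy.2
  rw [map_sub, map_sub] at key
  filter_upwards [Filter.Iic_mem_atBot d] with e he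
  have h1 : OrdDual.pos F e ≤ OrdDual.pos F d := apply_mono hpos he
  have h2 : 0 ≤ OrdDual.pos F e := apply_nonneg hpos (hglb.1 e.2)
  rw [Real.dist_eq, sub_zero, abs_of_nonneg h2]
  linarith

theorem IsOrderContinuous.abs {F : OrdDual L} (hF : F.IsOrderContinuous) :
    |F|.IsOrderContinuous := by
  -- This unfolds `F ⊔ -F` by the definition `f ⊔ g = g + pos (f - g)`.
  have : |F| = -F + OrdDual.pos (F + F) := by
    rw [← sub_neg_eq_add F F]
    rfl
  rw [this]
  exact hF.neg.add (hF.add hF).pos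

/-! ### Disjointness and domination in Riesz spaces. -/

/-- Two positive functionals are disjoint iff every positive element splits into parts on which
they are respectively small. -/
theorem inf_eq_zero_iff {f g : OrdDual L} (hf : 0 ≤ f) (hg : 0 ≤ g) :
    f ⊓ g = 0 ↔ ∀ b : L, 0 ≤ b → ∀ ε : ℝ, 0 < ε → ∃ c, 0 ≤ c ∧ c ≤ b ∧ f c + g (b - c) < ε := by
  have hinf : ∀ b, 0 ≤ b → (f ⊓ g) b = f b - posSup (f - g) b := fun b hb => by
    rw [← posLin_apply _ hb]; rfl
  constructor
  · intro h b hb ε hε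
    have h0 := hinf b hb
    rw [h, zero_apply] at h0
    obtain ⟨_, ⟨y, hy, rfl⟩, hlt⟩ := exists_lt_of_lt_csSup
      (⟨(f - g) 0, 0, ⟨le_rfl, hb⟩, rfl⟩ : ((f - g) '' Icc 0 b).Nonempty)
      (show f b - ε < posSup (f - g) b by linarith)
    refine ⟨b - y, sub_nonneg.2 hy.2, sub_le_self b hy.1, ?_⟩
    rw [sub_sub_cancel, map_sub]
    rw [sub_apply] at hlt
    linarith
  · intro h
    refine le_antisymm (fun b hb => ?_) (le_inf hf hg)
    refine le_of_forall_pos_le_add fun ε hε => ?_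
    obtain ⟨c, hc, hcb, hlt⟩ := h b hb ε hε
    have := le_posSup (f - g) (sub_nonneg.2 hcb) (sub_le_self b hc)
    rw [sub_apply, map_sub f] at this
    rw [hinf b hb, zero_apply]
    linarith

/-- By disjointness `|x| + |y| = |x| ⊔ |y| = ||x| - |y||`, which the reverse triangle inequality
bounds by `|x - y|`. -/
theorem abs_sub_eq_add_of_inf_eq_zero {x y : L} (h : |x| ⊓ |y| = 0) : |x - y| = |x| + |y| := by
  have e : ∀ u v : L, |u| ⊓ |v| = 0 → |u| + |v| ≤ |u - v| := by
    intro u v huv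
    have h1 : |u| + |v| - (|u| ⊓ |v|) = |u| ⊔ |v| := by
      rw [← inf_add_sup |u| |v|, add_sub_cancel_left]
    have h2 : |(|u| - |v|)| = |u| ⊔ |v| := by
      rw [← sub_zero (|u| ⊔ |v|), ← huv, sup_sub_inf_eq_abs_sub, abs_sub_comm]
    rw [huv, sub_zero] at h1
    rw [h1, ← h2]
    exact abs_abs_sub_abs_le u v
  exact le_antisymm (by simpa [sub_eq_add_neg] using abs_add_le x (-y)) (e x y h)

theorem inf_le_inf_add_inf {x y z : L} (hx : 0 ≤ x) (hy : 0 ≤ y) (hz : 0 ≤ z) : x ⊓ (y + z) ≤ x ⊓ y + x ⊓ z := by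
  rw [add_inf, inf_add, inf_add]
  exact le_inf (le_inf (inf_le_left.trans (le_add_of_nonneg_left hx))
    (inf_le_left.trans (le_add_of_nonneg_left hy)))
    (le_inf (inf_le_left.trans (le_add_of_nonneg_right hz)) inf_le_right)

theorem abs_smul_of_pos {c : ℝ} (hc : 0 < c) (x : L) : |c • x| = c • |x| := by
  have key : ∀ d : ℝ, 0 < d → ∀ y : L, |d • y| ≤ d • |y| := fun d hd y => by
    refine abs_le'.2 ⟨smul_le_smul_of_nonneg_left (le_abs_self y) hd.le, ?_⟩
    rw [← smul_neg]
    exact smul_le_smul_of_nonneg_left (neg_le_abs y) hd.le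
  refine le_antisymm (key c hc x) ?_
  have := smul_le_smul_of_nonneg_left (key c⁻¹ (inv_pos.2 hc) (c • x)) hc.le
  rwa [inv_smul_smul₀ hc.ne', smul_inv_smul₀ hc.ne'] at this

/-- **Hahn–Banach**: a functional on the domain of `T` dominated by the seminorm
`x ↦ H |T x|` factors through `T` with a factor which is dominated by `H`. -/
theorem exists_factor_of_abs_le {E : Type*} [AddCommGroup E] [Module ℝ E] (T : E →ₗ[ℝ] L)
    (φ : E →ₗ[ℝ] ℝ) {H : OrdDual L} (hH : 0 ≤ H) (h : ∀ x, |φ x| ≤ H |T x|) :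
    ∃ G : OrdDual L, (∀ x, G (T x) = φ x) ∧ ∀ y, |G y| ≤ H |y| := by
  have hker : LinearMap.ker T ≤ LinearMap.ker φ := fun x hx => by
    have := h x
    rw [LinearMap.mem_ker.1 hx, abs_zero, map_zero] at this
    exact abs_nonpos_iff.1 this
  -- `φ` vanishes on the kernel of `T`, so it descends to the range, where it is extended.
  let ψ : LinearMap.range T →ₗ[ℝ] ℝ := (LinearMap.ker T).liftQ φ hker ∘ₗ
    (T.quotKerEquivRange.symm : LinearMap.range T →ₗ[ℝ] E ⧸ LinearMap.ker T)
  have hψ : ∀ x, ψ ⟨T x, x, rfl⟩ = φ x := fun x => by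
    have : T.quotKerEquivRange.symm ⟨T x, x, rfl⟩ = (LinearMap.ker T).mkQ x := by
      rw [LinearEquiv.symm_apply_eq]
      rfl
    simp only [ψ, LinearMap.comp_apply, LinearEquiv.coe_coe]
    rw [this]
    rfl
  obtain ⟨G, hG, hGle⟩ := exists_extension_of_le_sublinear ⟨LinearMap.range T, ψ⟩ (fun y => H |y|)
    (fun c hc y => by rw [abs_smul_of_pos hc, map_smul, smul_eq_mul])
    (fun x y => by rw [← map_add]; exact apply_mono hH (abs_add_le x y))
    (by
      rintro ⟨_, x, rfl⟩
      exact (le_abs_self _).trans ((congrArg _ (hψ x)).le.trans (h x)))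
  have hGabs : ∀ y, |G y| ≤ H |y| := fun y => abs_le'.2 ⟨hGle y, by
    have := hGle (-y)
    rwa [map_neg, abs_neg] at this⟩
  refine ⟨mk G fun x y => ⟨H (|x| + |y|), fun z hz => (hGabs z).trans (apply_mono hH ?_)⟩,
    fun x => (hG ⟨T x, x, rfl⟩).trans (hψ x), hGabs⟩
  refine abs_le'.2 ⟨?_, ?_⟩
  · exact (hz.2.trans (le_abs_self y)).trans (le_add_of_nonneg_left (abs_nonneg x))
  · exact ((neg_le_neg hz.1).trans (neg_le_abs x)).trans (le_add_of_nonneg_right (abs_nonneg y))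

end RieszSpace

end OrdDual

/-! ### Multiplication inequalities in an `f`-algebra. -/

section FAlgebra

variable {A : Type*} [NonUnitalRing A] [Module ℝ A] [Lattice A] [IsFAlgebra A]

namespace IsFAlgebra

theorem mul_le_mul_left_of_nonneg {a b c : A} (hc : 0 ≤ c) (h : a ≤ b) : c * a ≤ c * b :=
  (OrdDual.mul_mem_Icc hc (x := a) ⟨h, le_rfl⟩).1

/-- Multiplying each factor in turn shows that `a * b` is disjoint from `b`, then from itself. -/
theorem mul_eq_zero_of_inf_eq_zero {a b : A} (h : a ⊓ b = 0) : a * b = 0 := by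
  have ha : 0 ≤ a := h ▸ inf_le_left
  have hb : 0 ≤ b := h ▸ inf_le_right
  have h1 := IsFAlgebra.mul_right_disjoint a b b h hb
  rw [inf_comm] at h1
  simpa using IsFAlgebra.mul_left_disjoint b (a * b) a h1 ha

theorem mul_posPart_self_nonneg (x : A) : 0 ≤ x * x⁺ := by
  have h : x⁻ * x⁺ = 0 := mul_eq_zero_of_inf_eq_zero (by rw [inf_comm, posPart_inf_negPart_eq_zero])
  have : x * x⁺ = x⁺ * x⁺ := by
    nth_rw 1 [← posPart_sub_negPart x]
    rw [sub_mul, h, sub_zero]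
  rw [this]
  exact IsFAlgebra.mul_nonneg _ _ (posPart_nonneg x) (posPart_nonneg x)

/-- The operator inequality `t π ≤ t² + π²` for the multiplication `π` by a positive element. -/
theorem smul_mul_le {a c : A} (ha : 0 ≤ a) (hc : 0 ≤ c) {t : ℝ} (ht : 0 ≤ t) :
    t • (a * c) ≤ (t * t) • c + a * (a * c) := by
  -- The claim is `a * x ≥ -t² c`, so only `a * x⁻` matters. It is at most `t² c + t x⁺`, and the
  -- last term drops out because `a * x⁻` is disjoint from `x⁺`.
  set x := a * c - t • c with hx
  have hac := IsFAlgebra.mul_nonneg a c ha hc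
  have htc : 0 ≤ t • c := smul_nonneg ht hc
  have httc : 0 ≤ (t * t) • c := smul_nonneg (_root_.mul_nonneg ht ht) hc
  have hxn : x⁻ ≤ t • c := by
    rw [negPart_def]
    refine sup_le ?_ htc
    rw [hx, neg_sub]
    exact sub_le_self _ hac
  have hd : a * x⁻ ⊓ x⁺ = 0 :=
    IsFAlgebra.mul_left_disjoint _ _ _ (by rw [inf_comm, posPart_inf_negPart_eq_zero]) ha
  have hd' : a * x⁻ ⊓ t • x⁺ = 0 := by
    have hp := posPart_nonneg x
    have hq := IsFAlgebra.mul_nonneg _ _ ha (negPart_nonneg x)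
    refine le_antisymm ?_ (le_inf hq (smul_nonneg ht hp))
    have h1 : a * x⁻ ⊓ t • x⁺ ≤ (1 + t) • (a * x⁻) ⊓ (1 + t) • x⁺ := by
      refine inf_le_inf ?_ (smul_le_smul_of_nonneg_right (by linarith) hp)
      rw [add_smul, one_smul]
      exact le_add_of_nonneg_right (smul_nonneg ht hq)
    have h2 : (1 + t) • (a * x⁻) ⊓ (1 + t) • x⁺ ≤ 0 := by
      have ht1 : 0 < 1 + t := by linarith
      have : (1 + t)⁻¹ • ((1 + t) • (a * x⁻) ⊓ (1 + t) • x⁺) ≤ a * x⁻ ⊓ x⁺ := by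
        refine le_inf ?_ ?_
        · exact (smul_le_smul_of_nonneg_left inf_le_left (inv_nonneg.2 ht1.le)).trans
            (inv_smul_smul₀ ht1.ne' _).le
        · exact (smul_le_smul_of_nonneg_left inf_le_right (inv_nonneg.2 ht1.le)).trans
            (inv_smul_smul₀ ht1.ne' _).le
      rw [hd] at this
      have := smul_le_smul_of_nonneg_left this ht1.le
      rwa [smul_inv_smul₀ ht1.ne', smul_zero] at this
    exact h1.trans h2
  have hle : a * x⁻ ≤ (t * t) • c + t • x⁺ := by
    calc a * x⁻ ≤ a * (t • c) := mul_le_mul_left_of_nonneg ha hxn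
      _ = t • (a * c) := mul_smul_comm _ _ _
      _ = (t * t) • c + t • x := by rw [hx, smul_sub, smul_smul]; abel
      _ ≤ _ := add_le_add le_rfl (smul_le_smul_of_nonneg_left (le_posPart x) ht)
  have hle' : a * x⁻ ≤ (t * t) • c := by
    calc a * x⁻ = a * x⁻ ⊓ ((t * t) • c + t • x⁺) := (inf_eq_left.2 hle).symm
      _ ≤ a * x⁻ ⊓ (t * t) • c + a * x⁻ ⊓ t • x⁺ := OrdDual.inf_le_inf_add_inf
          (IsFAlgebra.mul_nonneg _ _ ha (negPart_nonneg x)) httc (smul_nonneg ht (posPart_nonneg x))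
      _ ≤ (t * t) • c := by rw [hd', add_zero]; exact inf_le_right
  have hfin : -((t * t) • c) ≤ a * x := by
    rw [← posPart_sub_negPart x, mul_sub]
    exact (neg_le_neg hle').trans (by
      rw [sub_eq_add_neg]
      exact le_add_of_nonneg_left (IsFAlgebra.mul_nonneg _ _ ha (posPart_nonneg x)))
  rw [hx, mul_sub, mul_smul_comm] at hfin
  rw [← sub_nonneg] at hfin ⊢
  convert hfin using 1
  abel

end IsFAlgebra

/-! ### The identity `|f · a| = |f| · |a|`. -/

namespace OrdDual

theorem dotElem_nonneg {f : OrdDual A} (hf : 0 ≤ f) {a : A} (ha : 0 ≤ a) : 0 ≤ dotElem f a :=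
  fun _ hb => hf _ (IsFAlgebra.mul_nonneg _ _ ha hb)

theorem dotElem_sub (f : OrdDual A) (a b : A) : dotElem f (a - b) = dotElem f a - dotElem f b := by
  ext x
  simp [sub_mul]

theorem dotElem_add (f : OrdDual A) (a b : A) : dotElem f (a + b) = dotElem f a + dotElem f b := by
  ext x
  simp [add_mul]

theorem sub_dotElem (f g : OrdDual A) (a : A) : dotElem (f - g) a = dotElem f a - dotElem g a :=
  rfl

theorem add_dotElem (f g : OrdDual A) (a : A) : dotElem (f + g) a = dotElem f a + dotElem g a :=
  rfl

/-- Split `b` at `b ⊓ n u`. The first part is annihilated by `a`; the rest is `(b - n u)⁺`, and `n u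
(b - n u)⁺ ≤ b²`, so `f · u` is at most `f (b²) / n` there. -/
theorem dotElem_inf_eq_zero {f : OrdDual A} (hf : 0 ≤ f) {a u : A} (h : a ⊓ u = 0) :
    dotElem f a ⊓ dotElem f u = 0 := by
  have ha : 0 ≤ a := h ▸ inf_le_left
  have hu : 0 ≤ u := h ▸ inf_le_right
  rw [inf_eq_zero_iff (dotElem_nonneg hf ha) (dotElem_nonneg hf hu)]
  intro b hb ε hε
  obtain ⟨n, hn⟩ := exists_nat_gt (f (b * b) / ε)
  have hbb : 0 ≤ f (b * b) := hf _ (IsFAlgebra.mul_nonneg _ _ hb hb)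
  have hn0 : (0 : ℝ) < n := (div_nonneg hbb hε.le).trans_lt hn
  have hnu : 0 ≤ (n : ℝ) • u := smul_nonneg hn0.le hu
  refine ⟨b ⊓ (n : ℝ) • u, le_inf hb hnu, inf_le_left, ?_⟩
  have h1 : a * (b ⊓ (n : ℝ) • u) = 0 := by
    refine le_antisymm ?_ (IsFAlgebra.mul_nonneg _ _ ha (le_inf hb hnu))
    refine (IsFAlgebra.mul_le_mul_left_of_nonneg ha inf_le_right).trans ?_
    rw [mul_smul_comm, IsFAlgebra.mul_eq_zero_of_inf_eq_zero h, smul_zero]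
  have h2 : b - b ⊓ (n : ℝ) • u = (b - (n : ℝ) • u)⁺ := by
    rw [posPart_def, sub_inf, sub_self, sup_comm]
  have h3 : (b - (n : ℝ) • u)⁺ ≤ b := by
    rw [← h2]
    exact sub_le_self _ (le_inf hb hnu)
  have h4 : (n : ℝ) • (u * (b - (n : ℝ) • u)⁺) ≤ b * b := by
    have := IsFAlgebra.mul_posPart_self_nonneg (b - (n : ℝ) • u)
    rw [sub_mul b, sub_nonneg, smul_mul_assoc] at this
    exact this.trans (IsFAlgebra.mul_le_mul_left_of_nonneg hb h3)
  have h5 := apply_mono hf h4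
  rw [map_smul, smul_eq_mul] at h5
  rw [dotElem_apply, dotElem_apply, h1, h2, map_zero, zero_add]
  rw [div_lt_iff₀ hε] at hn
  exact lt_of_mul_lt_mul_left (h5.trans_lt hn) hn0.le

/-- Smallness of `f c` does not by itself bound `f (a * c)`. The inequality `n π ≤ n² + π²` repairs
this: `f (a c) + g (a (b - c)) ≤ n (f c + g (b - c)) + M / n`. First `n` is chosen to make `M / n <
ε / 2`, then `c` to make the other term less than `ε / 2`. -/
theorem dotElem_inf_dotElem_eq_zero {f g : OrdDual A} (h : f ⊓ g = 0) {a : A} (ha : 0 ≤ a) :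
    dotElem f a ⊓ dotElem g a = 0 := by
  have hf : 0 ≤ f := h ▸ inf_le_left
  have hg : 0 ≤ g := h ▸ inf_le_right
  rw [inf_eq_zero_iff (dotElem_nonneg hf ha) (dotElem_nonneg hg ha)]
  intro b hb ε hε
  have hab : 0 ≤ a * (a * b) :=
    IsFAlgebra.mul_nonneg _ _ ha (IsFAlgebra.mul_nonneg _ _ ha hb)
  set M := f (a * (a * b)) + g (a * (a * b)) with hM
  have hM0 : 0 ≤ M := add_nonneg (hf _ hab) (hg _ hab)
  obtain ⟨n, hn⟩ := exists_nat_gt (2 * M / ε)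
  have hn0 : (0 : ℝ) < n := (div_nonneg (by linarith) hε.le).trans_lt hn
  obtain ⟨c, hc, hcb, hlt⟩ := (inf_eq_zero_iff hf hg).1 h b hb (ε / (2 * n)) (by positivity)
  refine ⟨c, hc, hcb, ?_⟩
  have key : ∀ k : OrdDual A, 0 ≤ k → ∀ d : A, 0 ≤ d → d ≤ b →
      n * k (a * d) ≤ n * n * k d + k (a * (a * b)) := by
    intro k hk d hd hdb
    have := apply_mono hk ((IsFAlgebra.smul_mul_le ha hd hn0.le).trans (add_le_add_right
      (IsFAlgebra.mul_le_mul_left_of_nonneg ha (IsFAlgebra.mul_le_mul_left_of_nonneg ha hdb)) _))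
    simpa using this
  have h1 := key f hf c hc hcb
  have h2 := key g hg (b - c) (sub_nonneg.2 hcb) (sub_le_self b hc)
  rw [lt_div_iff₀ (by positivity)] at hlt
  rw [div_lt_iff₀ hε] at hn
  rw [dotElem_apply, dotElem_apply]
  refine lt_of_mul_lt_mul_left ?_ hn0.le
  nlinarith

theorem abs_dotElem (f : OrdDual A) (a : A) : |dotElem f a| = dotElem |f| |a| := by
  have h1 : ∀ g : OrdDual A, 0 ≤ g → |dotElem g a| = dotElem g |a| := by
    intro g hg
    have hp := abs_of_nonneg (dotElem_nonneg hg (posPart_nonneg a))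
    have hn := abs_of_nonneg (dotElem_nonneg hg (negPart_nonneg a))
    conv_lhs => rw [← posPart_sub_negPart a]
    rw [dotElem_sub, abs_sub_eq_add_of_inf_eq_zero, hp, hn, ← dotElem_add, posPart_add_negPart]
    rw [hp, hn]
    exact dotElem_inf_eq_zero hg (posPart_inf_negPart_eq_zero a)
  have hp := h1 _ (posPart_nonneg f)
  have hn := h1 _ (negPart_nonneg f)
  conv_lhs => rw [← posPart_sub_negPart f]
  rw [sub_dotElem, abs_sub_eq_add_of_inf_eq_zero, hp, hn, ← add_dotElem, posPart_add_negPart]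
  rw [hp, hn]
  exact dotElem_inf_dotElem_eq_zero (posPart_inf_negPart_eq_zero f) (abs_nonneg a)

/-- The linear map `a ↦ f · a`. -/
def dotElemLin (f : OrdDual A) : A →ₗ[ℝ] OrdDual A where
  toFun := dotElem f
  map_add' := dotElem_add f
  map_smul' c a := by
    ext x
    simp [smul_mul_assoc]

/-! ### Description of `R(f)` by domination. -/

theorem abs_dot_le (F : OrdDual (OrdDual A)) (f : OrdDual A) : |dot F f| ≤ dot |F| |f| := by
  have key : ∀ a : A, 0 ≤ a → |dot F f a| ≤ dot |F| |f| a := fun a ha => by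
    have := abs_apply_le F (dotElem f a)
    rwa [abs_dotElem, abs_of_nonneg ha] at this
  refine abs_le'.2 ⟨fun a ha => (le_abs_self _).trans (key a ha), fun a ha => ?_⟩
  exact (neg_le_abs _).trans (key a ha)

theorem mem_R_iff {f g : OrdDual A} :
    g ∈ R f ↔ ∃ H : OrdDual (OrdDual A), 0 ≤ H ∧ H.IsOrderContinuous ∧ |g| ≤ dot H |f| := by
  constructor
  · rintro ⟨F, hF, rfl⟩
    exact ⟨|F|, abs_nonneg F, hF.abs, abs_dot_le F f⟩
  · rintro ⟨H, hH, hHc, hg⟩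
    -- The domination is `|g a| ≤ |g| |a| ≤ H (|f| · |a|) = H |f · a|`.
    obtain ⟨G, hG, hGle⟩ := exists_factor_of_abs_le (dotElemLin f) g.toLin hH fun a => by
      change |g a| ≤ H |dotElem f a|
      rw [abs_dotElem]
      exact (abs_apply_le g a).trans (hg _ (abs_nonneg a))
    refine ⟨G, hHc.of_abs_le fun x hx => ?_, ext hG⟩
    have := hGle x
    rwa [abs_of_nonneg hx] at this

/-- `R(f)` as a linear subspace of the order dual. -/
def submoduleR (f : OrdDual A) : Submodule ℝ (OrdDual A) where
  carrier := R f
  zero_mem' := ⟨0, isOrderContinuous_zero, rfl⟩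
  add_mem' := by
    rintro _ _ ⟨F, hF, rfl⟩ ⟨G, hG, rfl⟩
    exact ⟨F + G, hF.add hG, rfl⟩
  smul_mem' := by
    rintro c _ ⟨F, hF, rfl⟩
    exact ⟨c • F, hF.smul c, rfl⟩

end OrdDual

end FAlgebra

theorem corollary2p3 {A : Type*} [NonUnitalRing A] [Module ℝ A] [Lattice A] [IsFAlgebra A]
    (hA : HasSeparatingOrdDual A) (f : OrdDual A) :
    OrdDual.R f = OrdDual.R |f| ∧ IsOrderIdeal (OrdDual.R f) := by
  refine ⟨?_, ⟨OrdDual.submoduleR f, rfl⟩, ?_⟩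
  · ext g
    rw [OrdDual.mem_R_iff, OrdDual.mem_R_iff, abs_abs]
  · intro h hh g hgh
    obtain ⟨H, hH, hHc, hle⟩ := OrdDual.mem_R_iff.1 hh
    exact OrdDual.mem_R_iff.2 ⟨H, hH, hHc, hgh.trans hle⟩
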